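/- Fix integers $m,k$ with $1\le k<m$ and let $n=2m$, $[n]=\{1,\dots,n\}$. **Definitions.** Let $d\ge 1$ be an integer. A pure abstract simplicial complex of dimension $d$ on $n$ vertices is a finite set $\Gamma$ of subsets of $[n]$ of cardinality $d+1$, called its facets; its complement is the complex with facets $[n]\setminus\tau$, $\tau\in\Gamma$. A real $d\times(d+1)$ matrix $M$ is positively spanning if the numbers $(-1)^i\operatorname{minor}(M,i)$, where $\operatorname{minor}(M,i)$ is the determinant of $M$ with its $i$-th column removed, are all nonzero and of the same sign. $\Gamma$ (of dimension $d$) is positively decorable if there is a real $d\times n$ matrix $C$ such that for every facet $\tau$ the submatrix of $C$ formed by the columns indexed by $\tau$ is positively spanning. Let $A\subset\mathbb R^d$ be a finite set with full-dimensional convex hull $Q$. A triangulation of $Q$ with vertices in $A$ is regular if there is a convex function $\nu:Q\to\mathbb R$ that is affine on each simplex of the triangulation but not affine on the union of any two different facets. $\Gamma$ (of dimension $d$) is regular if it is isomorphic to a (perhaps non-proper) subcomplex of a regular triangulation of some finite point configuration $A\subset\mathbb R^d$. Let $\mathbf S_{2m,2k-1}$ be the pure $(2k-1)$-dimensional complex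 on $[2m]$ whose facets are the sets $\{i_1,i_1+1,\dots,i_k,i_k+1\}$, where $i_1<\dots<i_k$ are elements of $[2m]$, no two of them cyclically consecutive modulo $2m$, such that there is no $j$ with $i_j$ even and $i_j+2\in\{i_1,\dots,i_k\}$; here $i_j+1$ and $i_j+2$ are taken modulo $2m$ in $[2m]$. (These are facets of the boundary of the cyclic $2k$-polytope with $2m$ vertices.) **Theorem.** For all $1\le k<m$: 1. Let $\mathbf S'_{2m,2k-1}$ be the image of $\mathbf S_{2m,2k-1}$ under the relabelling of vertices $(1,2,3,4,\dots,2m-1,2m)\mapsto(2,1,4,3,\dots,2m,2m-1)$, which swaps the labels $i$ and $i+1$ for every odd $i$. Then $\mathbf S'_{2m,2k-1}$ is the complement of $\mathbf S_{2m,2m-2k-1}$. 2. $\mathbf S_{2m,2k-1}$ is positively decorable. 3. If $k\ge 2$, then $\mathbf S_{2m,2k-1}$ is regular. -/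

import Mathlib

/-! Vertices `1, …, n` are modelled by `Fin n`: the element `i : Fin n` stands for the label
`i.val + 1`, so that odd labels are the `i` with `i.val` even.  A pure complex on `n` vertices is
given by its finite set of facets. -/

/-- `Γ` is (the set of facets of) a pure abstract simplicial complex of dimension `d` on the vertex
set `Fin n`. -/
def IsPureComplex {n : ℕ} (d : ℕ) (Γ : Finset (Finset (Fin n))) : Prop :=
  ∀ τ ∈ Γ, τ.card = d + 1

/-- The complement complex: its facets are the complements of the facets of `Γ`. -/
def complementComplex {n : ℕ} (Γ : Finset (Finset (Fin n))) : Finset (Finset (Fin n)) :=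
  Γ.image (fun τ => τᶜ)

/-- The image of `Γ` under a relabelling `f` of the vertices. -/
def relabelComplex {n : ℕ} (f : Equiv.Perm (Fin n)) (Γ : Finset (Finset (Fin n))) :
    Finset (Finset (Fin n)) :=
  Γ.image (fun τ => τ.image f)

/-- A `d × (d + 1)` real matrix is positively spanning if the signed maximal minors
`(-1) ^ i * minor (M, i)` (column `i` removed) are all nonzero and of the same sign. -/
def PositivelySpanning {d : ℕ} (M : Matrix (Fin d) (Fin (d + 1)) ℝ) : Prop :=
  (∀ i : Fin (d + 1), 0 < (-1 : ℝ) ^ (i : ℕ) * (M.submatrix id i.succAbove).det) ∨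
  (∀ i : Fin (d + 1), (-1 : ℝ) ^ (i : ℕ) * (M.submatrix id i.succAbove).det < 0)

/-- A `d`-dimensional pure complex on `n` vertices is positively decorable if there is a real
`d × n` matrix `C` such that, for every facet `τ`, the submatrix of `C` formed by the columns
indexed by `τ` (in increasing order) is positively spanning. -/
def PositivelyDecorable {n : ℕ} (d : ℕ) (Γ : Finset (Finset (Fin n))) : Prop :=
  ∃ C : Matrix (Fin d) (Fin n) ℝ,
    ∀ τ ∈ Γ, ∃ h : τ.card = d + 1, PositivelySpanning (C.submatrix id (τ.orderEmbOfFin h))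

/-- `K` is a triangulation of the point configuration `A ⊆ ℝ^d`, whose convex hull is required to
be full-dimensional: `K` is a geometric simplicial complex, its vertices belong to `A`, and it
covers the convex hull of `A`. -/
structure IsTriangulation {d : ℕ} (K : Geometry.SimplicialComplex ℝ (Fin d → ℝ))
    (A : Finset (Fin d → ℝ)) : Prop where
  full_dim : affineSpan ℝ (A : Set (Fin d → ℝ)) = ⊤
  face_subset : ∀ s ∈ K.faces, s ⊆ A
  space_eq : K.space = convexHull ℝ (A : Set (Fin d → ℝ))

/-- A triangulation `K` of `A` is regular if there is a convex function `ν` on `conv A` which is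
affine on each simplex of `K`, but not affine on the union of two different facets of `K`. -/
def IsRegularTriangulation {d : ℕ} (K : Geometry.SimplicialComplex ℝ (Fin d → ℝ))
    (A : Finset (Fin d → ℝ)) : Prop :=
  IsTriangulation K A ∧
  ∃ ν : (Fin d → ℝ) → ℝ,
    ConvexOn ℝ (convexHull ℝ (A : Set (Fin d → ℝ))) ν ∧
    (∀ s ∈ K.faces, ∃ f : (Fin d → ℝ) →ᵃ[ℝ] ℝ,
      Set.EqOn ν f (convexHull ℝ (s : Set (Fin d → ℝ)))) ∧
    (∀ s ∈ K.facets, ∀ t ∈ K.facets, s ≠ t → ¬ ∃ f : (Fin d → ℝ) →ᵃ[ℝ] ℝ,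
      Set.EqOn ν f (convexHull ℝ (s : Set (Fin d → ℝ)) ∪ convexHull ℝ (t : Set (Fin d → ℝ))))

open Classical in
/-- A `d`-dimensional pure complex is regular if it is isomorphic, through a map `φ` that is
injective on its vertices, to a (perhaps non-proper) subcomplex of a regular triangulation of some
point configuration in `ℝ^d`. -/
def IsRegularComplex {n : ℕ} (d : ℕ) (Γ : Finset (Finset (Fin n))) : Prop :=
  IsPureComplex d Γ ∧
  ∃ (A : Finset (Fin d → ℝ)) (K : Geometry.SimplicialComplex ℝ (Fin d → ℝ))
    (φ : Fin n → (Fin d → ℝ)),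
    IsRegularTriangulation K A ∧
    Set.InjOn φ {v | ∃ τ ∈ Γ, v ∈ τ} ∧
    ∀ τ ∈ Γ, τ.image φ ∈ K.faces

/-- The cyclic successor on the labels `1, …, n`: `i ↦ i + 1` for `i < n`, and `n ↦ 1`. -/
def cyclicSucc {n : ℕ} (i : Fin n) : Fin n :=
  ⟨(i.val + 1) % n, Nat.mod_lt _ i.pos⟩

/-- The facets of the complex `S_{2m, 2k-1}`.  A stable set `I = {i_1, …, i_k}` of size `k` in the
cycle of length `2m` represents the facet `{i_1, i_1 + 1, …, i_k, i_k + 1}` (labels taken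
cyclically) of the boundary of the cyclic `2k`-polytope with `2m` vertices; the facet belongs to
`S_{2m, 2k-1}` if there is no `i ∈ I` with even label (that is, with odd `i.val`) such that `i + 2`,
taken cyclically, is in `I` too. -/
def SComplex (m k : ℕ) : Finset (Finset (Fin (2 * m))) :=
  (Finset.univ.filter (fun I : Finset (Fin (2 * m)) =>
    I.card = k ∧
    (∀ i ∈ I, cyclicSucc i ∉ I) ∧
    (∀ i ∈ I, Odd i.val → cyclicSucc (cyclicSucc i) ∉ I))).image
  (fun I => I ∪ I.image cyclicSucc)

/-- The relabelling `(1, 2, 3, 4, …, 2m-1, 2m) ↦ (2, 1, 4, 3, …, 2m, 2m-1)`. -/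
def pairSwap (m : ℕ) : Equiv.Perm (Fin (2 * m)) :=
  Function.Involutive.toPerm
    (fun i => if h : i.val % 2 = 0 then ⟨i.val + 1, by omega⟩ else ⟨i.val - 1, by omega⟩)
    (by
      intro i
      apply Fin.ext
      by_cases h : i.val % 2 = 0
      · have h' : (i.val + 1) % 2 ≠ 0 := by omega
        simp [h, h']
      · have h' : (i.val - 1) % 2 = 0 := by omega
        simp only [h, h', dite_true, dite_false]
        omega)

/-! Group the vertices into the `m` pairs with values `2a, 2a + 1`. A set of size `2k` is a facet
exactly when every pair met only in its right element is followed cyclically by a pair met only in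
its left element, and conversely (`mem_SComplex_iff`). Swapping within pairs and complementing both
exchange left-only and right-only pairs, which gives part 1.

After the swap, the sorted elements of a facet alternate in parity
(`IsPairBalanced.exists_alternating`). Decorate a vertex of swapped value `x` with `(-1) ^ x` times
its moment vector: the signed minors on a facet become positive Vandermonde determinants times a
common sign.

For regularity, place the vertices on the moment curve in dimension `2k`. Polynomials of degree at
most `2k` are the affine functions there, and a functional `l` with `l 1 = 1` plays the role of a
point. For `k ≥ 2` the cyclic polytope has a facet `baseFacet` outside the complex; take `l` just
beyond it, so that the supporting polynomials of all facets of the complex stay positive at `l`.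
Project centrally from `l`, sending to infinity a hyperplane `H` through `l` that misses the
polytope. The facets of the complex land in the lower hull for the heights `1 / H`
(`isRegularComplex_of_supporting_polynomials`), and lower hulls of simplicial heights are regular
triangulations (`isRegularTriangulation_lowerHullComplex`). -/

/-! ### Facets as pair-balanced sets, and the complement. -/

section PairedCycle

variable {m : ℕ}

theorem cyclicSucc_val {n : ℕ} (i : Fin n) :
    (cyclicSucc i).val = if i.val + 1 = n then 0 else i.val + 1 := by
  have := i.isLt
  unfold cyclicSucc
  split_ifs with h
  · simp [h]
  · exact Nat.mod_eq_of_lt (by omega)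

theorem pairSwap_val (i : Fin (2 * m)) :
    (pairSwap m i).val = if i.val % 2 = 0 then i.val + 1 else i.val - 1 := by
  change (if h : i.val % 2 = 0 then (⟨i.val + 1, by omega⟩ : Fin (2 * m))
    else ⟨i.val - 1, by omega⟩).val = _
  split_ifs <;> rfl

@[simp]
theorem pairSwap_pairSwap (i : Fin (2 * m)) : pairSwap m (pairSwap m i) = i := by
  apply Fin.ext
  rw [pairSwap_val, pairSwap_val]
  split_ifs <;> omega

theorem cyclicSucc_injective {n : ℕ} : Function.Injective (cyclicSucc (n := n)) := by
  intro i j h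
  have h' := congrArg Fin.val h
  rw [cyclicSucc_val, cyclicSucc_val] at h'
  apply Fin.ext
  split_ifs at h' <;> omega

theorem odd_cyclicSucc_iff (i : Fin (2 * m)) : Odd (cyclicSucc i).val ↔ ¬ Odd i.val := by
  rw [cyclicSucc_val, Nat.odd_iff, Nat.odd_iff]
  split_ifs with h
  · have : i.val % 2 = 1 := by omega
    simp [this]
  · omega

theorem odd_pairSwap_iff (i : Fin (2 * m)) : Odd (pairSwap m i).val ↔ ¬ Odd i.val := by
  rw [pairSwap_val, Nat.odd_iff, Nat.odd_iff]
  split_ifs <;> omega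

theorem cyclicSucc_eq_pairSwap {i : Fin (2 * m)} (hi : ¬ Odd i.val) :
    cyclicSucc i = pairSwap m i := by
  rw [Nat.odd_iff] at hi
  apply Fin.ext
  rw [cyclicSucc_val, pairSwap_val]
  split_ifs <;> omega

theorem cyclicSucc_pairSwap {i : Fin (2 * m)} (hi : Odd i.val) :
    cyclicSucc (pairSwap m i) = i := by
  rw [cyclicSucc_eq_pairSwap (by rwa [odd_pairSwap_iff, not_not]), pairSwap_pairSwap]

theorem cyclicSucc_cyclicSucc {i : Fin (2 * m)} (hi : Odd i.val) :
    cyclicSucc (cyclicSucc i) = pairSwap m (cyclicSucc i) :=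
  cyclicSucc_eq_pairSwap (by rwa [odd_cyclicSucc_iff, not_not])

theorem exists_cyclicSucc_eq {n : ℕ} (i : Fin n) : ∃ j, cyclicSucc j = i :=
  Finite.surjective_of_injective cyclicSucc_injective i

theorem card_union_image_cyclicSucc {n : ℕ} {I : Finset (Fin n)} (hI : ∀ i ∈ I, cyclicSucc i ∉ I) :
    (I ∪ I.image cyclicSucc).card = 2 * I.card := by
  rw [Finset.card_union_of_disjoint, Finset.card_image_of_injective _ cyclicSucc_injective, two_mul]
  rw [Finset.disjoint_left]
  intro i hi hi'
  obtain ⟨j, hj, rfl⟩ := Finset.mem_image.1 hi'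
  exact hI j hj hi

/-- `τ` contains exactly the right element of a pair if and only if it contains exactly the left
element of the next pair. -/
def IsPairBalanced (τ : Finset (Fin (2 * m))) : Prop :=
  ∀ i : Fin (2 * m), Odd i.val →
    ((i ∈ τ ∧ pairSwap m i ∉ τ) ↔ (cyclicSucc i ∈ τ ∧ pairSwap m (cyclicSucc i) ∉ τ))

theorem exists_of_mem_SComplex {k : ℕ} {τ : Finset (Fin (2 * m))} (h : τ ∈ SComplex m k) :
    ∃ I : Finset (Fin (2 * m)), I.card = k ∧ I ∪ I.image cyclicSucc = τ ∧
      (∀ i ∈ I, cyclicSucc i ∉ I) ∧ (∀ i ∈ I, Odd i.val → cyclicSucc (cyclicSucc i) ∉ I) := by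
  obtain ⟨I, hI, rfl⟩ := Finset.mem_image.1 h
  obtain ⟨-, h1, h2, h3⟩ := Finset.mem_filter.1 hI
  exact ⟨I, h1, rfl, h2, h3⟩

/-- If a right element `i` lies in the facet without its partner, it is not there as a successor, so
`i ∈ I`. Its successor is then in the facet, and stability keeps the next vertex out. The converse
is symmetric. -/
theorem isPairBalanced_of_stable {I : Finset (Fin (2 * m))} (h2 : ∀ i ∈ I, cyclicSucc i ∉ I)
    (h3 : ∀ i ∈ I, Odd i.val → cyclicSucc (cyclicSucc i) ∉ I) :
    IsPairBalanced (I ∪ I.image cyclicSucc) := by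
  have mem_iff : ∀ i, cyclicSucc i ∈ I ∪ I.image cyclicSucc ↔ cyclicSucc i ∈ I ∨ i ∈ I := by
    intro i
    simp only [Finset.mem_union, Finset.mem_image, cyclicSucc_injective.eq_iff, exists_eq_right]
  intro i hi
  have hp := cyclicSucc_pairSwap hi
  obtain ⟨j, hj⟩ := exists_cyclicSucc_eq (pairSwap m i)
  have hj' : Odd j.val := by
    by_contra h
    rw [← odd_cyclicSucc_iff, hj, odd_pairSwap_iff] at h
    exact h hi
  rw [← cyclicSucc_cyclicSucc hi, mem_iff, mem_iff]
  have e1 := mem_iff (pairSwap m i)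
  rw [hp] at e1
  have e2 := mem_iff j
  rw [hj] at e2
  rw [e1, e2]
  have a1 := h2 i
  have a3 := h2 (pairSwap m i)
  rw [hp] at a3
  have a4 := h3 j
  rw [hj, hp] at a4
  have a5 := fun h => h3 i h hi
  constructor
  · rintro ⟨h, h'⟩
    rw [not_or] at h'
    have hI := h.resolve_right h'.1
    exact ⟨Or.inr hI, fun h => h.elim (a5 hI) (a1 hI)⟩
  · rintro ⟨h, h'⟩
    rw [not_or] at h'
    have hI := h.resolve_left h'.2
    exact ⟨Or.inl hI, fun h => h.elim (fun h => a3 h hI) (fun h => a4 h hj' hI)⟩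

theorem IsPairBalanced.exists_stable {τ : Finset (Fin (2 * m))} (h : IsPairBalanced τ) :
    ∃ I : Finset (Fin (2 * m)), I ∪ I.image cyclicSucc = τ ∧
      (∀ i ∈ I, cyclicSucc i ∉ I) ∧ (∀ i ∈ I, Odd i.val → cyclicSucc (cyclicSucc i) ∉ I) := by
  classical
  -- `I` takes the left element of each full pair and the right element of each right-only pair;
  -- balance makes the left-only elements successors of the latter.
  let I := τ.filter (fun i => Odd i.val ↔ pairSwap m i ∉ τ)
  have hI : ∀ i, i ∈ I ↔ i ∈ τ ∧ (Odd i.val ↔ pairSwap m i ∉ τ) := fun i => Finset.mem_filter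
  refine ⟨I, ?_, ?_, ?_⟩
  · apply Finset.Subset.antisymm
    · intro i hi
      rcases Finset.mem_union.1 hi with hi | hi
      · exact ((hI i).1 hi).1
      · obtain ⟨j, hj, rfl⟩ := Finset.mem_image.1 hi
        rw [hI] at hj
        by_cases hodd : Odd j.val
        · exact ((h j hodd).1 ⟨hj.1, hj.2.1 hodd⟩).1
        · rw [cyclicSucc_eq_pairSwap hodd]
          tauto
    · intro i hi
      rw [Finset.mem_union, Finset.mem_image]
      by_cases hodd : Odd i.val <;> by_cases hp : pairSwap m i ∈ τ
      · refine Or.inr ⟨pairSwap m i, ?_, cyclicSucc_pairSwap hodd⟩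
        rw [hI, odd_pairSwap_iff, pairSwap_pairSwap]
        tauto
      · exact Or.inl ((hI i).2 ⟨hi, by tauto⟩)
      · exact Or.inl ((hI i).2 ⟨hi, by tauto⟩)
      · obtain ⟨j, rfl⟩ := exists_cyclicSucc_eq i
        rw [odd_cyclicSucc_iff, not_not] at hodd
        refine Or.inr ⟨j, ?_, rfl⟩
        have := (h j hodd).2 ⟨hi, hp⟩
        rw [hI]
        tauto
  · intro i hi hs
    rw [hI] at hi hs
    rw [odd_cyclicSucc_iff] at hs
    by_cases hodd : Odd i.val
    · have := h i hodd
      tauto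
    · rw [cyclicSucc_eq_pairSwap hodd, pairSwap_pairSwap] at hs
      tauto
  · intro i hi hodd hs
    rw [hI] at hi hs
    have := h i hodd
    rw [cyclicSucc_cyclicSucc hodd] at hs
    tauto

theorem mem_SComplex_iff {k : ℕ} {τ : Finset (Fin (2 * m))} :
    τ ∈ SComplex m k ↔ τ.card = 2 * k ∧ IsPairBalanced τ := by
  constructor
  · intro h
    obtain ⟨I, rfl, rfl, h2, h3⟩ := exists_of_mem_SComplex h
    exact ⟨card_union_image_cyclicSucc h2, isPairBalanced_of_stable h2 h3⟩
  · rintro ⟨hc, h⟩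
    obtain ⟨I, rfl, h2, h3⟩ := h.exists_stable
    rw [card_union_image_cyclicSucc h2] at hc
    exact Finset.mem_image.2 ⟨I, Finset.mem_filter.2 ⟨Finset.mem_univ _, by omega, h2, h3⟩, rfl⟩

theorem mem_image_pairSwap {τ : Finset (Fin (2 * m))} {i : Fin (2 * m)} :
    i ∈ τ.image (pairSwap m) ↔ pairSwap m i ∈ τ := by
  rw [Finset.mem_image]
  constructor
  · rintro ⟨j, hj, rfl⟩
    rwa [pairSwap_pairSwap]
  · exact fun h => ⟨_, h, pairSwap_pairSwap i⟩

theorem image_pairSwap_image_pairSwap (τ : Finset (Fin (2 * m))) :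
    (τ.image (pairSwap m)).image (pairSwap m) = τ := by
  ext i
  rw [mem_image_pairSwap, mem_image_pairSwap, pairSwap_pairSwap]

/-- Both operations turn left-only pairs into right-only ones and back; they differ only on full and
empty pairs, which balance does not see. -/
theorem isPairBalanced_image_pairSwap_iff {τ : Finset (Fin (2 * m))} :
    IsPairBalanced (τ.image (pairSwap m)) ↔ IsPairBalanced τᶜ := by
  unfold IsPairBalanced
  simp only [mem_image_pairSwap, pairSwap_pairSwap, Finset.mem_compl, not_not]
  simp only [and_comm]

theorem relabel_SComplex_eq_complement {k : ℕ} (hkm : k < m) :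
    relabelComplex (pairSwap m) (SComplex m k) = complementComplex (SComplex m (m - k)) := by
  ext σ
  have h1 : σ ∈ relabelComplex (pairSwap m) (SComplex m k) ↔
      σ.image (pairSwap m) ∈ SComplex m k := by
    unfold relabelComplex
    rw [Finset.mem_image]
    constructor
    · rintro ⟨τ, hτ, rfl⟩
      rwa [image_pairSwap_image_pairSwap]
    · exact fun h => ⟨_, h, image_pairSwap_image_pairSwap σ⟩
  have h2 : σ ∈ complementComplex (SComplex m (m - k)) ↔ σᶜ ∈ SComplex m (m - k) := by
    unfold complementComplex
    rw [Finset.mem_image]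
    constructor
    · rintro ⟨τ, hτ, rfl⟩
      rwa [compl_compl]
    · exact fun h => ⟨_, h, compl_compl σ⟩
  have hcard : σ.card ≤ 2 * m := by simpa using Finset.card_le_univ σ
  rw [h1, h2, mem_SComplex_iff, mem_SComplex_iff, isPairBalanced_image_pairSwap_iff,
    Finset.card_image_of_injective _ (pairSwap m).injective, Finset.card_compl, Fintype.card_fin]
  refine and_congr_left fun _ => ?_
  omega

end PairedCycle

/-! ### Positive decoration by a signed moment curve. -/

section Decoration

variable {m : ℕ}

/-- The indicator sequence of a set of vertices, extended by `False`. -/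
def memSeq {n : ℕ} (σ : Finset (Fin n)) (x : ℕ) : Prop := ∃ h : x < n, (⟨x, h⟩ : Fin n) ∈ σ

instance {n : ℕ} (σ : Finset (Fin n)) : DecidablePred (memSeq σ) := fun x =>
  inferInstanceAs (Decidable (∃ h : x < n, (⟨x, h⟩ : Fin n) ∈ σ))

theorem count_memSeq_orderEmbOfFin {n d : ℕ} (σ : Finset (Fin n)) (h : σ.card = d) (j : Fin d) :
    Nat.count (memSeq σ) (σ.orderEmbOfFin h j).val = j.val := by
  rw [Nat.count_eq_card_filter_range]
  have : (Finset.range (σ.orderEmbOfFin h j).val).filter (memSeq σ) =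
      (Finset.Iio j).image (fun l => (σ.orderEmbOfFin h l).val) := by
    ext x
    simp only [Finset.mem_filter, Finset.mem_range, Finset.mem_image, Finset.mem_Iio]
    constructor
    · rintro ⟨hx, hn, hσ⟩
      have : (⟨x, hn⟩ : Fin n) ∈ Set.range (σ.orderEmbOfFin h) := by
        rw [Finset.range_orderEmbOfFin]
        exact hσ
      obtain ⟨l, hl⟩ := this
      refine ⟨l, ?_, by rw [hl]⟩
      rw [← (σ.orderEmbOfFin h).lt_iff_lt, hl]
      exact hx
    · rintro ⟨l, hl, rfl⟩
      exact ⟨(σ.orderEmbOfFin h).strictMono hl, Fin.isLt _, σ.orderEmbOfFin_mem h l⟩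
  rw [this, Finset.card_image_of_injective, Fin.card_Iio]
  exact fun a b hab => (σ.orderEmbOfFin h).injective (Fin.ext hab)

theorem memSeq_image_pairSwap_even (τ : Finset (Fin (2 * m))) {a : ℕ} (ha : a < m) :
    memSeq (τ.image (pairSwap m)) (2 * a) ↔ memSeq τ (2 * a + 1) := by
  have : pairSwap m ⟨2 * a, by omega⟩ = ⟨2 * a + 1, by omega⟩ := by
    apply Fin.ext
    rw [pairSwap_val]
    simp
  constructor
  · rintro ⟨h, h'⟩
    rw [mem_image_pairSwap, this] at h'
    exact ⟨_, h'⟩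
  · rintro ⟨h, h'⟩
    refine ⟨by omega, ?_⟩
    rwa [mem_image_pairSwap, this]

theorem memSeq_image_pairSwap_odd (τ : Finset (Fin (2 * m))) {a : ℕ} (ha : a < m) :
    memSeq (τ.image (pairSwap m)) (2 * a + 1) ↔ memSeq τ (2 * a) := by
  rw [← memSeq_image_pairSwap_even _ ha, image_pairSwap_image_pairSwap]

theorem IsPairBalanced.memSeq_iff {τ : Finset (Fin (2 * m))} (h : IsPairBalanced τ) {a : ℕ}
    (ha : a + 1 < m) :
    (memSeq τ (2 * a + 1) ∧ ¬ memSeq τ (2 * a)) ↔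
      (memSeq τ (2 * (a + 1)) ∧ ¬ memSeq τ (2 * (a + 1) + 1)) := by
  have e1 : cyclicSucc (⟨2 * a + 1, by omega⟩ : Fin (2 * m)) = ⟨2 * (a + 1), by omega⟩ := by
    apply Fin.ext
    rw [cyclicSucc_val]
    simp only
    split_ifs <;> omega
  have e2 : pairSwap m ⟨2 * a + 1, by omega⟩ = ⟨2 * a, by omega⟩ := by
    apply Fin.ext
    rw [pairSwap_val]
    simp only
    split_ifs <;> omega
  have e3 : pairSwap m ⟨2 * (a + 1), by omega⟩ = ⟨2 * (a + 1) + 1, by omega⟩ := by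
    apply Fin.ext
    rw [pairSwap_val]
    simp
  have := h ⟨2 * a + 1, by omega⟩ (by simp)
  rw [e1, e2, e3] at this
  have w : ∀ x (hx : x < 2 * m), memSeq τ x ↔ (⟨x, hx⟩ : Fin (2 * m)) ∈ τ :=
    fun x hx => ⟨fun ⟨_, h⟩ => h, fun h => ⟨hx, h⟩⟩
  rw [w _ (by omega), w _ (by omega), w _ (by omega), w _ (by omega)]
  exact this

theorem count_two_mul_succ (p : ℕ → Prop) [DecidablePred p] (a : ℕ) :
    Nat.count p (2 * (a + 1)) =
      Nat.count p (2 * a) + (if p (2 * a) then 1 else 0) + (if p (2 * a + 1) then 1 else 0) := by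
  rw [show 2 * (a + 1) = 2 * a + 1 + 1 by ring, Nat.count_succ, Nat.count_succ]

/-- Induction over pairs. Full and empty pairs change neither the parity of the count nor the
indicator. A left-only pair adds one and switches the indicator off; a right-only pair adds one and
switches it on. The constant `c` is the indicator of the first pair. -/
theorem IsPairBalanced.exists_count_parity {τ : Finset (Fin (2 * m))} (h : IsPairBalanced τ) :
    ∃ c : ℕ, ∀ a < m,
      (Nat.count (memSeq (τ.image (pairSwap m))) (2 * a) +
        (if memSeq τ (2 * a) ∧ ¬ memSeq τ (2 * a + 1) then 1 else 0) + c) % 2 = 0 := by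
  refine ⟨if memSeq τ 0 ∧ ¬ memSeq τ 1 then 1 else 0, fun a => ?_⟩
  induction a with
  | zero =>
    intro _
    simp only [mul_zero, Nat.count_zero]
    split_ifs <;> simp
  | succ a ih =>
    intro ha
    have ih := ih (by omega)
    have hb := h.memSeq_iff ha
    rw [count_two_mul_succ]
    simp only [memSeq_image_pairSwap_even τ (show a < m by omega),
      memSeq_image_pairSwap_odd τ (show a < m by omega), ← hb]
    generalize (if memSeq τ 0 ∧ ¬ memSeq τ 1 then 1 else 0) = c at *
    by_cases h0 : memSeq τ (2 * a) <;> by_cases h1 : memSeq τ (2 * a + 1) <;>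
      simp only [h0, h1, not_true_eq_false, not_false_eq_true, and_true, and_false, and_self,
        if_true, if_false] at ih ⊢ <;> omega

theorem IsPairBalanced.exists_alternating {τ : Finset (Fin (2 * m))} (h : IsPairBalanced τ) {d : ℕ}
    (hc : (τ.image (pairSwap m)).card = d) :
    ∃ c : ℕ, ∀ j : Fin d, (((τ.image (pairSwap m)).orderEmbOfFin hc j).val + j.val + c) % 2 = 0 := by
  obtain ⟨c, hc'⟩ := h.exists_count_parity
  refine ⟨c, fun j => ?_⟩
  have hcount := count_memSeq_orderEmbOfFin _ hc j
  have hmem : memSeq (τ.image (pairSwap m)) ((τ.image (pairSwap m)).orderEmbOfFin hc j).val :=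
    ⟨Fin.isLt _, Finset.orderEmbOfFin_mem _ hc j⟩
  have hlt := ((τ.image (pairSwap m)).orderEmbOfFin hc j).isLt
  generalize ((τ.image (pairSwap m)).orderEmbOfFin hc j).val = x at *
  rw [← hcount]
  have ha : x / 2 < m := by omega
  have := hc' (x / 2) ha
  rcases Nat.mod_two_eq_zero_or_one x with hx | hx
  · obtain ⟨a, rfl⟩ : ∃ a, x = 2 * a := ⟨x / 2, by omega⟩
    rw [Nat.mul_div_cancel_left _ two_pos] at this ha
    rw [memSeq_image_pairSwap_even τ ha] at hmem
    simp only [hmem, not_true_eq_false, and_false, if_false] at this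
    omega
  · obtain ⟨a, rfl⟩ : ∃ a, x = 2 * a + 1 := ⟨x / 2, by omega⟩
    rw [show (2 * a + 1) / 2 = a by omega] at this ha
    have hmem' := hmem
    rw [memSeq_image_pairSwap_odd τ ha] at hmem'
    rw [Nat.count_succ]
    have e := memSeq_image_pairSwap_even τ ha
    by_cases h1 : memSeq τ (2 * a + 1)
    · simp only [e, h1, hmem', not_true_eq_false, and_false, if_false, if_true] at this ⊢
      omega
    · simp only [e, h1, hmem', not_false_eq_true, and_true, if_false, if_true] at this ⊢
      omega

/-- Laplace expansion along a unit row; as full determinants, the signed minors visibly transform by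
the sign of a column permutation. -/
theorem signed_minor_eq_det {d : ℕ} (M : Matrix (Fin d) (Fin (d + 1)) ℝ) (i : Fin (d + 1)) :
    (-1 : ℝ) ^ (i : ℕ) * (M.submatrix id i.succAbove).det =
      (Matrix.of (Matrix.vecCons (Pi.single i 1) M)).det := by
  rw [Matrix.det_succ_row_zero, Finset.sum_eq_single i]
  · simp
    rfl
  · intro j _ hj
    simp [hj]
  · simp

theorem PositivelySpanning.of_perm {d : ℕ} {M : Matrix (Fin d) (Fin (d + 1)) ℝ}
    (h : PositivelySpanning M) (ρ : Equiv.Perm (Fin (d + 1))) :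
    PositivelySpanning (M.submatrix id ρ) := by
  have key : ∀ i : Fin (d + 1),
      (-1 : ℝ) ^ (i : ℕ) * ((M.submatrix id ρ).submatrix id i.succAbove).det =
        ((Equiv.Perm.sign ρ : ℤ) : ℝ) *
          ((-1 : ℝ) ^ ((ρ i : Fin (d + 1)) : ℕ) * (M.submatrix id (ρ i).succAbove).det) := by
    intro i
    rw [signed_minor_eq_det, signed_minor_eq_det, ← Matrix.det_permute']
    congr 1
    ext r c
    refine Fin.cases ?_ (fun r => ?_) r
    · simp [Pi.single_apply]
    · rfl
  unfold PositivelySpanning at h ⊢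
  simp only [key]
  rcases Int.units_eq_one_or (Equiv.Perm.sign ρ) with hs | hs <;> rw [hs] <;>
    rcases h with h | h
  · exact Or.inl fun i => by simpa using h (ρ i)
  · exact Or.inr fun i => by simpa using h (ρ i)
  · exact Or.inr fun i => by simpa using h (ρ i)
  · exact Or.inl fun i => by simpa using h (ρ i)

/-- Removing column `i` drops the factor `(-1) ^ x i` from the product of column signs; by
alternation this and `(-1) ^ i` combine to `(-1) ^ c`, whatever `i` is. -/
theorem positivelySpanning_alternating_moment {d : ℕ} (x : Fin (d + 1) → ℕ) (hx : StrictMono x)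
    (c : ℕ) (hc : ∀ j, (x j + j.val + c) % 2 = 0) :
    PositivelySpanning (Matrix.of fun (r : Fin d) j => (-1 : ℝ) ^ x j * (x j : ℝ) ^ (r : ℕ)) := by
  have key : ∀ i : Fin (d + 1), ∃ V : ℝ, 0 < V ∧
      (-1 : ℝ) ^ (i : ℕ) * ((Matrix.of fun (r : Fin d) j => (-1 : ℝ) ^ x j * (x j : ℝ) ^ (r : ℕ)
        ).submatrix id i.succAbove).det = (-1) ^ c * (∏ j, (-1 : ℝ) ^ x j) * V := by
    intro i
    refine ⟨(Matrix.vandermonde fun j => (x (i.succAbove j) : ℝ)).det, ?_, ?_⟩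
    · rw [Matrix.det_vandermonde]
      refine Finset.prod_pos fun a _ => Finset.prod_pos fun b hb => ?_
      rw [sub_pos, Nat.cast_lt]
      exact hx (Fin.strictMono_succAbove i (Finset.mem_Ioi.1 hb))
    · have e : ((Matrix.of fun (r : Fin d) j => (-1 : ℝ) ^ x j * (x j : ℝ) ^ (r : ℕ)
          ).submatrix id i.succAbove) = Matrix.of fun r j => (-1 : ℝ) ^ x (i.succAbove j) *
            (Matrix.vandermonde fun j => (x (i.succAbove j) : ℝ)).transpose r j := by
        ext r j
        simp [Matrix.vandermonde_apply]
      rw [e, Matrix.det_mul_row, Matrix.det_transpose, Fin.prod_univ_succAbove _ i, ← mul_assoc,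
        ← mul_assoc, ← pow_add]
      congr 2
      rw [neg_one_pow_eq_pow_mod_two, neg_one_pow_eq_pow_mod_two (n := c + x i)]
      have := hc i
      congr 1
      omega
  have hs : (-1 : ℝ) ^ c * (∏ j, (-1 : ℝ) ^ x j) = 1 ∨
      (-1 : ℝ) ^ c * (∏ j, (-1 : ℝ) ^ x j) = -1 := by
    rw [Finset.prod_pow_eq_pow_sum, ← pow_add]
    exact neg_one_pow_eq_or ℝ _
  rcases hs with hs | hs
  · refine Or.inl fun i => ?_
    obtain ⟨V, hV, h⟩ := key i
    rw [h, hs, one_mul]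
    exact hV
  · refine Or.inr fun i => ?_
    obtain ⟨V, hV, h⟩ := key i
    rw [h, hs, neg_one_mul]
    exact neg_neg_of_pos hV

theorem exists_perm_orderEmbOfFin_image {n d : ℕ} (f : Equiv.Perm (Fin n)) (τ : Finset (Fin n))
    (h : τ.card = d) (h' : (τ.image f).card = d) :
    ∃ ρ : Equiv.Perm (Fin d), ∀ j,
      f (τ.orderEmbOfFin h j) = (τ.image f).orderEmbOfFin h' (ρ j) := by
  have : ∀ j, ∃ l, (τ.image f).orderEmbOfFin h' l = f (τ.orderEmbOfFin h j) := by
    intro j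
    have : f (τ.orderEmbOfFin h j) ∈ Set.range ((τ.image f).orderEmbOfFin h') := by
      rw [Finset.range_orderEmbOfFin]
      exact Finset.mem_image_of_mem _ (τ.orderEmbOfFin_mem h j)
    exact this
  choose ρ hρ using this
  have hinj : Function.Injective ρ := by
    intro a b hab
    have := congrArg ((τ.image f).orderEmbOfFin h') hab
    rw [hρ, hρ] at this
    exact (τ.orderEmbOfFin h).injective (f.injective this)
  exact ⟨Equiv.ofBijective ρ (Finite.injective_iff_bijective.1 hinj), fun j => (hρ j).symm⟩

theorem positivelyDecorable_SComplex {k : ℕ} (hk : 1 ≤ k) :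
    PositivelyDecorable (2 * k - 1) (SComplex m k) := by
  refine ⟨Matrix.of fun r i => (-1 : ℝ) ^ (pairSwap m i).val * ((pairSwap m i).val : ℝ) ^ (r : ℕ),
    fun τ hτ => ?_⟩
  obtain ⟨hcard, hb⟩ := mem_SComplex_iff.1 hτ
  have h : τ.card = 2 * k - 1 + 1 := by omega
  have h' : (τ.image (pairSwap m)).card = 2 * k - 1 + 1 := by
    rw [Finset.card_image_of_injective _ (pairSwap m).injective, h]
  obtain ⟨ρ, hρ⟩ := exists_perm_orderEmbOfFin_image (pairSwap m) τ h h'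
  obtain ⟨c, hc⟩ := hb.exists_alternating h'
  refine ⟨h, ?_⟩
  -- Alternation holds in the order of the swapped labels, while the columns follow the original
  -- order; `ρ` passes between the two.
  convert (positivelySpanning_alternating_moment _
    (fun a b hab => ((τ.image (pairSwap m)).orderEmbOfFin h').strictMono hab) c hc).of_perm ρ
    using 1
  ext r j
  simp [hρ]

end Decoration

/-! ### Regular triangulations from lower hulls. -/

section LowerHull

variable {E : Type*} [NormedAddCommGroup E] [NormedSpace ℝ E]

/-- `f` is an affine function lying below the heights `ω` on `A`. -/
def IsAffineMinorant (A : Finset E) (ω : E → ℝ) (f : E →ᵃ[ℝ] ℝ) : Prop := ∀ a ∈ A, f a ≤ ω a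

/-- The points of `A` at which `f` attains the height `ω`. -/
noncomputable def contactSet (A : Finset E) (ω : E → ℝ) (f : E →ᵃ[ℝ] ℝ) : Finset E :=
  open Classical in A.filter fun a => f a = ω a

variable {A : Finset E} {ω : E → ℝ} {f : E →ᵃ[ℝ] ℝ}

theorem mem_contactSet {a : E} : a ∈ contactSet A ω f ↔ a ∈ A ∧ f a = ω a := by
  classical exact Finset.mem_filter

theorem contactSet_subset : contactSet A ω f ⊆ A := fun _ h => (mem_contactSet.1 h).1

theorem AffineSubspace.exists_affineMap_ne_zero {S : AffineSubspace ℝ E} (hS : S ≠ ⊤) :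
    ∃ g : E →ᵃ[ℝ] ℝ, g ≠ 0 ∧ ∀ x ∈ S, g x = 0 := by
  rcases S.eq_bot_or_nonempty with rfl | ⟨p, hp⟩
  · refine ⟨AffineMap.const ℝ E 1, fun h => ?_, fun x hx => hx.elim⟩
    simpa using congrArg (fun g : E →ᵃ[ℝ] ℝ => g 0) h
  · have hd : S.direction < ⊤ := by
      rw [lt_top_iff_ne_top]
      intro h
      exact hS ((AffineSubspace.direction_eq_top_iff_of_nonempty ⟨p, hp⟩).1 h)
    obtain ⟨φ, hφ, hle⟩ := Submodule.exists_le_ker_of_lt_top _ hd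
    refine ⟨φ.toAffineMap - AffineMap.const ℝ E (φ p), fun h => hφ ?_, fun x hx => ?_⟩
    · ext x
      have h1 := congrArg (fun g : E →ᵃ[ℝ] ℝ => g x) h
      have h0 := congrArg (fun g : E →ᵃ[ℝ] ℝ => g 0) h
      simp at h1 h0
      simpa [h0] using h1
    · have := hle (AffineSubspace.vsub_mem_direction hx hp)
      simpa using this

theorem AffineMap.eq_sum_of_weights (g : E →ᵃ[ℝ] ℝ) {s : Finset E} {w : E → ℝ}
    (hw : ∑ y ∈ s, w y = 1) : g (∑ y ∈ s, w y • y) = ∑ y ∈ s, w y * g y := by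
  have h : ∀ y, g y = g.linear y + g 0 := fun y => by
    have := g.decomp
    exact congrFun this y
  have h' : ∑ y ∈ s, w y * g y = ∑ y ∈ s, (w y * g.linear y + w y * g 0) :=
    Finset.sum_congr rfl fun y _ => by rw [h y, mul_add]
  rw [h', h, map_sum, Finset.sum_add_distrib, ← Finset.sum_mul, hw, one_mul]
  simp only [map_smul, smul_eq_mul]

theorem AffineMap.exists_pos_of_mem_convexHull (g : E →ᵃ[ℝ] ℝ) {x : E}
    (hx : x ∈ convexHull ℝ (A : Set E)) (hg : 0 < g x) : ∃ a ∈ A, 0 < g a := by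
  by_contra! h
  obtain ⟨w, hw0, hw1, rfl⟩ := Finset.mem_convexHull'.1 hx
  rw [g.eq_sum_of_weights hw1] at hg
  exact absurd hg (not_lt.2 (Finset.sum_nonpos fun y hy =>
    mul_nonpos_of_nonneg_of_nonpos (hw0 y hy) (h y hy)))

/-- A minorant whose contact set does not span can be pushed until it touches a new point. -/
theorem IsAffineMinorant.exists_contactSet_ssubset (hf : IsAffineMinorant A ω f)
    (hA : affineSpan ℝ (A : Set E) = ⊤) {x : E} (hx : x ∈ convexHull ℝ (A : Set E))
    (hT : affineSpan ℝ (contactSet A ω f : Set E) ≠ ⊤) :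
    ∃ f', IsAffineMinorant A ω f' ∧ contactSet A ω f ⊂ contactSet A ω f' ∧ f x ≤ f' x := by
  classical
  obtain ⟨g₀, hg₀, hz₀⟩ := AffineSubspace.exists_affineMap_ne_zero hT
  -- The sign of `g₀` is chosen so that moving along `g` does not lower the value at `x` and is
  -- eventually blocked by a point of `A`.
  obtain ⟨g, hz, hgx, hpos⟩ : ∃ g : E →ᵃ[ℝ] ℝ, (∀ a ∈ contactSet A ω f, g a = 0) ∧ 0 ≤ g x ∧
      ∃ a ∈ A, 0 < g a := by
    have hz : ∀ a ∈ contactSet A ω f, g₀ a = 0 := fun a ha => hz₀ a (subset_affineSpan ℝ _ ha)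
    rcases lt_trichotomy (g₀ x) 0 with h | h | h
    · refine ⟨-g₀, fun a ha => by simp [hz a ha], by simpa using h.le, ?_⟩
      exact AffineMap.exists_pos_of_mem_convexHull _ hx (by simpa using h)
    · have : ∃ a ∈ A, g₀ a ≠ 0 := by
        by_contra! h'
        exact hg₀ (AffineMap.ext_on hA fun a ha => h' a ha)
      obtain ⟨a, ha, hne⟩ := this
      rcases hne.lt_or_gt with h' | h'
      · exact ⟨-g₀, fun a ha => by simp [hz a ha], by simp [h], a, ha, by simpa using h'⟩
      · exact ⟨g₀, hz, h.ge, a, ha, h'⟩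
    · exact ⟨g₀, hz, h.le, AffineMap.exists_pos_of_mem_convexHull _ hx h⟩
  obtain ⟨a₀, ha₀, hmin⟩ := Finset.exists_min_image (A.filter fun a => 0 < g a)
    (fun a => (ω a - f a) / g a) (by
      obtain ⟨a, ha, h⟩ := hpos
      exact ⟨a, Finset.mem_filter.2 ⟨ha, h⟩⟩)
  obtain ⟨ha₀, hg₀⟩ := Finset.mem_filter.1 ha₀
  -- The largest step that keeps a minorant; `a₀` becomes the new contact point.
  set ε := (ω a₀ - f a₀) / g a₀ with hε
  have hε0 : 0 ≤ ε := div_nonneg (sub_nonneg.2 (hf a₀ ha₀)) hg₀.le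
  have happ : ∀ y, (f + ε • g) y = f y + ε * g y := fun y => rfl
  refine ⟨f + ε • g, fun a ha => ?_, ?_, ?_⟩
  · rw [happ]
    rcases le_or_gt (g a) 0 with h | h
    · have := hf a ha
      have := mul_nonpos_of_nonneg_of_nonpos hε0 h
      linarith
    · have := (le_div_iff₀ h).1 (hmin a (Finset.mem_filter.2 ⟨ha, h⟩))
      linarith
  · rw [Finset.ssubset_iff_of_subset]
    · refine ⟨a₀, mem_contactSet.2 ⟨ha₀, ?_⟩, fun h => hg₀.ne' (hz a₀ h)⟩
      rw [happ, hε, div_mul_cancel₀ _ hg₀.ne']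
      ring
    · intro a ha
      have h := mem_contactSet.1 ha
      exact mem_contactSet.2 ⟨h.1, by rw [happ, hz a ha, h.2]; ring⟩
  · rw [happ]
    nlinarith [mul_nonneg hε0 hgx]

theorem IsAffineMinorant.exists_spanning (hf : IsAffineMinorant A ω f)
    (hA : affineSpan ℝ (A : Set E) = ⊤) {x : E} (hx : x ∈ convexHull ℝ (A : Set E)) :
    ∃ f', IsAffineMinorant A ω f' ∧ contactSet A ω f ⊆ contactSet A ω f' ∧ f x ≤ f' x ∧
      affineSpan ℝ (contactSet A ω f' : Set E) = ⊤ := by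
  induction h : A.card - (contactSet A ω f).card using Nat.strong_induction_on generalizing f with
  | _ n ih =>
    by_cases hT : affineSpan ℝ (contactSet A ω f : Set E) = ⊤
    · exact ⟨f, hf, subset_rfl, le_rfl, hT⟩
    · obtain ⟨f₁, hf₁, hss, hle⟩ := hf.exists_contactSet_ssubset hA hx hT
      have h1 := Finset.card_lt_card hss
      have h2 := Finset.card_le_card (contactSet_subset (A := A) (ω := ω) (f := f₁))
      obtain ⟨f₂, hf₂, hs₂, hle₂, hT₂⟩ := ih _ (by omega) hf₁ rfl
      exact ⟨f₂, hf₂, hss.subset.trans hs₂, hle.trans hle₂, hT₂⟩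

theorem exists_isAffineMinorant (A : Finset E) (ω : E → ℝ) : ∃ f, IsAffineMinorant A ω f := by
  rcases A.eq_empty_or_nonempty with rfl | hA
  · exact ⟨0, fun a ha => by simp at ha⟩
  · obtain ⟨b, -, hb⟩ := A.exists_min_image ω hA
    exact ⟨AffineMap.const ℝ E (ω b), fun a ha => hb a ha⟩

/-- Every point of the convex hull lies over a lower face. -/
theorem exists_mem_convexHull_contactSet (ω : E → ℝ) (hA : affineSpan ℝ (A : Set E) = ⊤) {x : E}
    (hx : x ∈ convexHull ℝ (A : Set E)) :
    ∃ f, IsAffineMinorant A ω f ∧ x ∈ convexHull ℝ (contactSet A ω f : Set E) := by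
  classical
  -- A minorant with spanning contact set is determined by that set, so `F` is finite and some
  -- member is highest at `x`.
  let F : Set (E →ᵃ[ℝ] ℝ) := {f | IsAffineMinorant A ω f ∧
    affineSpan ℝ (contactSet A ω f : Set E) = ⊤}
  have hfin : F.Finite := by
    refine Set.Finite.of_finite_image (f := contactSet A ω) ?_ ?_
    · exact (A.powerset.finite_toSet).subset (by
        rintro _ ⟨f, -, rfl⟩
        exact Finset.mem_coe.2 (Finset.mem_powerset.2 contactSet_subset))
    · intro f hf g hg hfg
      refine AffineMap.ext_on hf.2 fun a ha => ?_
      have h1 := (mem_contactSet.1 ha).2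
      have ha' : a ∈ contactSet A ω g := hfg ▸ ha
      rw [h1, (mem_contactSet.1 ha').2]
  obtain ⟨f₀, hf₀⟩ := exists_isAffineMinorant A ω
  obtain ⟨f₁, hf₁, -, -, hT₁⟩ := hf₀.exists_spanning hA hx
  obtain ⟨f, ⟨hf, hT⟩, hmax⟩ := Set.exists_max_image F (fun f => f x) hfin ⟨f₁, hf₁, hT₁⟩
  refine ⟨f, hf, ?_⟩
  by_contra hnot
  -- If `x` is outside the contact hull, a slight tilt along `φ - u` is still a minorant but is
  -- higher at `x`; pushing it to a spanning one contradicts maximality.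
  obtain ⟨φ, u, hφ, hφx⟩ := geometric_hahn_banach_closed_point (convex_convexHull ℝ _)
    ((Finset.finite_toSet (contactSet A ω f)).isClosed_convexHull ℝ) hnot
  have hev : ∀ᶠ ε : ℝ in nhdsWithin 0 (Set.Ioi 0), ∀ a ∈ A, f a + ε * (φ a - u) ≤ ω a := by
    rw [Filter.eventually_all_finset]
    intro a ha
    by_cases hT : a ∈ contactSet A ω f
    · filter_upwards [self_mem_nhdsWithin] with ε hε
      have h1 := hφ a (subset_convexHull ℝ _ hT)
      have h2 := (mem_contactSet.1 hT).2
      have := mul_pos (Set.mem_Ioi.1 hε) (sub_pos.2 h1)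
      linarith
    · have hlt : f a < ω a := lt_of_le_of_ne (hf a ha) fun h => hT (mem_contactSet.2 ⟨ha, h⟩)
      have hc : ContinuousAt (fun ε : ℝ => f a + ε * (φ a - u)) 0 := by fun_prop
      have := hc.eventually_lt (continuousAt_const (y := ω a)) (by simpa using hlt)
      exact (this.filter_mono nhdsWithin_le_nhds).mono fun _ h => h.le
  obtain ⟨ε, hε, hεpos⟩ := (hev.and self_mem_nhdsWithin).exists
  let f' : E →ᵃ[ℝ] ℝ := f + ε • (φ.toLinearMap.toAffineMap - AffineMap.const ℝ E u)
  have happ : ∀ y, f' y = f y + ε * (φ y - u) := fun y => rfl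
  have hf' : IsAffineMinorant A ω f' := fun a ha => by rw [happ]; exact hε a ha
  obtain ⟨f₂, hf₂, -, hle, hT₂⟩ := hf'.exists_spanning hA hx
  have h1 := hmax f₂ ⟨hf₂, hT₂⟩
  have h2 := mul_pos (Set.mem_Ioi.1 hεpos) (sub_pos.2 hφx)
  rw [happ] at hle
  linarith

theorem IsAffineMinorant.le_of_mem_convexHull {g : E →ᵃ[ℝ] ℝ} (hg : IsAffineMinorant A ω g)
    {s : Finset E} (hs : s ⊆ contactSet A ω f) {x : E} (hx : x ∈ convexHull ℝ (s : Set E)) :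
    g x ≤ f x := by
  obtain ⟨w, hw0, hw1, rfl⟩ := Finset.mem_convexHull'.1 hx
  rw [g.eq_sum_of_weights hw1, f.eq_sum_of_weights hw1]
  refine Finset.sum_le_sum fun y hy => mul_le_mul_of_nonneg_left ?_ (hw0 y hy)
  have h := mem_contactSet.1 (hs hy)
  rw [h.2]
  exact hg y h.1

-- Equality of two convex combinations whose terms are ordered forces equality of every term, so the
-- weights live where `g` also touches.
open Classical in
theorem IsAffineMinorant.mem_convexHull_inter_contactSet {g : E →ᵃ[ℝ] ℝ}
    (hg : IsAffineMinorant A ω g) {s : Finset E} (hs : s ⊆ contactSet A ω f) {x : E}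
    (hx : x ∈ convexHull ℝ (s : Set E)) (hfg : g x = f x) :
    x ∈ convexHull ℝ ((s ∩ contactSet A ω g : Finset E) : Set E) := by
  obtain ⟨w, hw0, hw1, rfl⟩ := Finset.mem_convexHull'.1 hx
  rw [g.eq_sum_of_weights hw1, f.eq_sum_of_weights hw1] at hfg
  have hle : ∀ y ∈ s, w y * g y ≤ w y * f y := by
    intro y hy
    refine mul_le_mul_of_nonneg_left ?_ (hw0 y hy)
    have h := mem_contactSet.1 (hs hy)
    rw [h.2]
    exact hg y h.1
  have heq := (Finset.sum_eq_sum_iff_of_le hle).1 hfg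
  have hz : ∀ y ∈ s, y ∉ s ∩ contactSet A ω g → w y = 0 := by
    intro y hy hny
    by_contra hw
    have h := mem_contactSet.1 (hs hy)
    have := mul_left_cancel₀ hw (heq y hy)
    exact hny (Finset.mem_inter.2 ⟨hy, mem_contactSet.2 ⟨h.1, this.trans h.2⟩⟩)
  refine Finset.mem_convexHull'.2 ⟨w, fun y hy => hw0 y (Finset.mem_inter.1 hy).1, ?_, ?_⟩
  · rw [Finset.sum_subset Finset.inter_subset_left hz, hw1]
  · exact Finset.sum_subset Finset.inter_subset_left fun y hy hny => by rw [hz y hy hny, zero_smul]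

/-- Heights are simplicial if no affine minorant touches more points than a simplex has. -/
def IsSimplicialHeight (A : Finset E) (ω : E → ℝ) : Prop :=
  ∀ f, IsAffineMinorant A ω f → (contactSet A ω f).card ≤ Module.finrank ℝ E + 1

theorem affineIndependent_of_affineSpan_eq_top {s : Finset E}
    (hs : affineSpan ℝ (s : Set E) = ⊤) (hc : s.card ≤ Module.finrank ℝ E + 1) :
    AffineIndependent ℝ ((↑) : s → E) := by
  have hne : s.Nonempty := by
    rw [Finset.nonempty_iff_ne_empty]
    rintro rfl
    simp at hs
  have hcard : Fintype.card s = (s.card - 1) + 1 := by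
    rw [Fintype.card_coe]
    have := hne.card_pos
    omega
  rw [affineIndependent_iff_le_finrank_vectorSpan ℝ _ hcard, Subtype.range_coe_subtype]
  have : vectorSpan ℝ {x | x ∈ s} = ⊤ := by
    rw [← direction_affineSpan]
    change (affineSpan ℝ (s : Set E)).direction = ⊤
    rw [hs, AffineSubspace.direction_top]
  rw [this, finrank_top]
  omega

theorem nonempty_of_affineSpan_eq_top (hA : affineSpan ℝ (A : Set E) = ⊤) : A.Nonempty := by
  rw [Finset.nonempty_iff_ne_empty]
  rintro rfl
  simp at hA

/-- The contact set extends to a spanning one, which has at most `finrank + 1` points and so is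
independent. -/
theorem IsSimplicialHeight.affineIndependent (hω : IsSimplicialHeight A ω)
    (hA : affineSpan ℝ (A : Set E) = ⊤) (hf : IsAffineMinorant A ω f) :
    AffineIndependent ℝ ((↑) : contactSet A ω f → E) := by
  obtain ⟨a, ha⟩ := nonempty_of_affineSpan_eq_top hA
  obtain ⟨f', hf', hss, -, hT⟩ := hf.exists_spanning hA (subset_convexHull ℝ _ ha)
  exact (affineIndependent_of_affineSpan_eq_top hT (hω f' hf')).mono (Finset.coe_subset.2 hss)

/-- The projection of the lower hull of the points of `A` lifted to the heights `ω`. -/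
noncomputable def lowerHullComplex (hω : IsSimplicialHeight A ω)
    (hA : affineSpan ℝ (A : Set E) = ⊤) : Geometry.SimplicialComplex ℝ E where
  faces := {s | s.Nonempty ∧ ∃ f, IsAffineMinorant A ω f ∧ s ⊆ contactSet A ω f}
  isRelLowerSet_faces := by
    rintro s ⟨hs, f, hf, hsf⟩
    exact ⟨hs, fun t hts ht => ⟨ht, f, hf, Finset.Subset.trans hts hsf⟩⟩
  indep := by
    rintro s ⟨-, f, hf, hsf⟩
    exact (hω.affineIndependent hA hf).mono (Finset.coe_subset.2 hsf)
  inter_subset_convexHull := by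
    classical
    rintro s t ⟨-, f, hf, hsf⟩ ⟨-, g, hg, htg⟩ x ⟨hxs, hxt⟩
    -- Each minorant is dominated by the other on the other's face.
    have hfg : g x = f x :=
      le_antisymm (hg.le_of_mem_convexHull hsf hxs) (hf.le_of_mem_convexHull htg hxt)
    have hx := hg.mem_convexHull_inter_contactSet hsf hxs hfg
    have := (hω.affineIndependent hA hg).convexHull_inter (t₁ := s ∩ contactSet A ω g) (t₂ := t)
      Finset.inter_subset_right htg
    have hx' : x ∈ convexHull ℝ ((s ∩ contactSet A ω g : Finset E) ∩ t : Set E) := by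
      rw [this]
      exact ⟨hx, hxt⟩
    refine convexHull_mono ?_ hx'
    intro y hy
    exact ⟨(Finset.mem_inter.1 hy.1).1, hy.2⟩

theorem mem_lowerHullComplex_faces {hω : IsSimplicialHeight A ω}
    {hA : affineSpan ℝ (A : Set E) = ⊤} {s : Finset E} :
    s ∈ (lowerHullComplex hω hA).faces ↔
      s.Nonempty ∧ ∃ f, IsAffineMinorant A ω f ∧ s ⊆ contactSet A ω f :=
  Iff.rfl

theorem exists_of_mem_lowerHullComplex_facets {hω : IsSimplicialHeight A ω}
    {hA : affineSpan ℝ (A : Set E) = ⊤} {s : Finset E}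
    (hs : s ∈ (lowerHullComplex hω hA).facets) :
    ∃ f, IsAffineMinorant A ω f ∧ s = contactSet A ω f ∧ affineSpan ℝ (s : Set E) = ⊤ := by
  obtain ⟨⟨hne, f, hf, hsf⟩, hmax⟩ := hs
  obtain ⟨a, ha⟩ := nonempty_of_affineSpan_eq_top hA
  obtain ⟨f', hf', hss, -, hT⟩ := hf.exists_spanning hA (subset_convexHull ℝ _ ha)
  have hsub := Finset.Subset.trans hsf hss
  have heq : s = contactSet A ω f' :=
    hmax (mem_lowerHullComplex_faces.2 ⟨hne.mono hsub, f', hf', subset_rfl⟩) hsub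
  exact ⟨f', hf', heq, by rw [heq]; exact hT⟩

/-- The lower convex envelope of the heights. -/
noncomputable def lowerEnvelope (A : Finset E) (ω : E → ℝ) (x : E) : ℝ :=
  sSup {r | ∃ f, IsAffineMinorant A ω f ∧ f x = r}

theorem lowerEnvelope_eq (hf : IsAffineMinorant A ω f) {s : Finset E} (hs : s ⊆ contactSet A ω f)
    {x : E} (hx : x ∈ convexHull ℝ (s : Set E)) : lowerEnvelope A ω x = f x := by
  refine IsGreatest.csSup_eq ⟨⟨f, hf, rfl⟩, ?_⟩
  rintro _ ⟨g, hg, rfl⟩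
  exact hg.le_of_mem_convexHull hs hx

theorem bddAbove_minorant_values {x : E} (hx : x ∈ convexHull ℝ (A : Set E)) :
    BddAbove {r | ∃ f, IsAffineMinorant A ω f ∧ f x = r} := by
  obtain ⟨w, hw0, hw1, rfl⟩ := Finset.mem_convexHull'.1 hx
  refine ⟨∑ y ∈ A, w y * ω y, ?_⟩
  rintro _ ⟨g, hg, rfl⟩
  rw [g.eq_sum_of_weights hw1]
  exact Finset.sum_le_sum fun y hy => mul_le_mul_of_nonneg_left (hg y hy) (hw0 y hy)

theorem convexOn_lowerEnvelope (A : Finset E) (ω : E → ℝ) :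
    ConvexOn ℝ (convexHull ℝ (A : Set E)) (lowerEnvelope A ω) := by
  refine ⟨convex_convexHull ℝ _, fun x hx y hy a b ha hb hab => ?_⟩
  refine csSup_le ?_ ?_
  · obtain ⟨f, hf⟩ := exists_isAffineMinorant A ω
    exact ⟨_, f, hf, rfl⟩
  · rintro _ ⟨f, hf, rfl⟩
    rw [Convex.combo_affine_apply hab]
    exact add_le_add
      (smul_le_smul_of_nonneg_left (le_csSup (bddAbove_minorant_values hx) ⟨f, hf, rfl⟩) ha)
      (smul_le_smul_of_nonneg_left (le_csSup (bddAbove_minorant_values hy) ⟨f, hf, rfl⟩) hb)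

end LowerHull

theorem isRegularTriangulation_lowerHullComplex {d : ℕ} {A : Finset (Fin d → ℝ)}
    {ω : (Fin d → ℝ) → ℝ} (hω : IsSimplicialHeight A ω)
    (hA : affineSpan ℝ (A : Set (Fin d → ℝ)) = ⊤) :
    IsRegularTriangulation (lowerHullComplex hω hA) A := by
  refine ⟨⟨hA, ?_, ?_⟩, lowerEnvelope A ω, convexOn_lowerEnvelope A ω, ?_, ?_⟩
  · rintro s ⟨-, f, -, hsf⟩
    exact Finset.Subset.trans hsf contactSet_subset
  · ext x
    rw [Geometry.SimplicialComplex.mem_space_iff]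
    constructor
    · rintro ⟨s, ⟨-, f, -, hsf⟩, hx⟩
      exact convexHull_mono (Finset.coe_subset.2 (Finset.Subset.trans hsf contactSet_subset)) hx
    · intro hx
      obtain ⟨f, hf, hxf⟩ := exists_mem_convexHull_contactSet ω hA hx
      have hne : (contactSet A ω f).Nonempty :=
        Finset.coe_nonempty.1 (convexHull_nonempty_iff.1 ⟨x, hxf⟩)
      exact ⟨_, ⟨hne, f, hf, subset_rfl⟩, hxf⟩
  · rintro s ⟨-, f, hf, hsf⟩
    exact ⟨f, fun x hx => lowerEnvelope_eq hf hsf hx⟩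
  · rintro s hs t ht hst ⟨h, hh⟩
    obtain ⟨f, hf, rfl, hT⟩ := exists_of_mem_lowerHullComplex_facets hs
    obtain ⟨g, hg, rfl, -⟩ := exists_of_mem_lowerHullComplex_facets ht
    -- The contact set of `f` spans, so a common affine function must be `f`; then `f` touches every
    -- vertex of the second facet, against maximality.
    have hhf : h = f := by
      refine AffineMap.ext_on hT fun a ha => ?_
      have ha' := subset_convexHull ℝ _ ha
      rw [← hh (Or.inl ha'), lowerEnvelope_eq hf subset_rfl ha']
    refine hst (ht.2 hs.1 ?_).symm
    intro a ha
    have ha' := subset_convexHull ℝ _ (Finset.mem_coe.2 ha)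
    have hag := mem_contactSet.1 ha
    refine mem_contactSet.2 ⟨hag.1, ?_⟩
    rw [← hhf, ← hh (Or.inr ha'), lowerEnvelope_eq hg subset_rfl ha', hag.2]

/-! ### Central projection of the moment curve. -/

section MomentProjection

open Polynomial

variable {d n : ℕ} {x : Fin n → ℝ} {l : ℝ[X] →ₗ[ℝ] ℝ} {H : ℝ[X]}

theorem Polynomial.card_filter_eval_eq_zero_le {g : ℝ[X]} (hg : g ≠ 0) (hx : Function.Injective x) :
    (Finset.univ.filter fun i => g.eval (x i) = 0).card ≤ g.natDegree := by
  classical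
  rw [← Finset.card_image_of_injective _ hx]
  refine le_trans (Finset.card_le_card (t := g.roots.toFinset) ?_)
    ((Multiset.toFinset_card_le _).trans g.card_roots')
  intro y hy
  obtain ⟨i, hi, rfl⟩ := Finset.mem_image.1 hy
  rw [Multiset.mem_toFinset, mem_roots hg]
  exact (Finset.mem_filter.1 hi).2

/-- The points of the moment curve, in the affine chart given by `H` on the kernel of `l`. -/
noncomputable def projectedMoment (d : ℕ) (x : Fin n → ℝ) (l : ℝ[X] →ₗ[ℝ] ℝ) (H : ℝ[X])
    (i : Fin n) : Fin d → ℝ :=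
  fun j => (x i ^ (j.val + 1) - l (X ^ (j.val + 1))) / H.eval (x i)

/-- The polynomial in the kernel of `l` with given coordinates. -/
noncomputable def kernelPolynomial (l : ℝ[X] →ₗ[ℝ] ℝ) (H : ℝ[X]) (c : ℝ) (a : Fin d → ℝ) : ℝ[X] :=
  c • H + ∑ j, a j • (X ^ (j.val + 1) - C (l (X ^ (j.val + 1))))

theorem LinearMap.map_polynomial_C (h1 : l 1 = 1) (r : ℝ) : l (C r) = r := by
  rw [← mul_one (C r), ← smul_eq_C_mul, map_smul, h1, smul_eq_mul, mul_one]

theorem map_kernelPolynomial (h1 : l 1 = 1) (hH : l H = 0) (c : ℝ) (a : Fin d → ℝ) :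
    l (kernelPolynomial l H c a) = 0 := by
  simp [kernelPolynomial, hH, LinearMap.map_polynomial_C h1]

theorem natDegree_kernelPolynomial_le (hd : H.natDegree = d + 1) (c : ℝ) (a : Fin d → ℝ) :
    (kernelPolynomial l H c a).natDegree ≤ d + 1 := by
  refine (natDegree_add_le_of_degree_le ((natDegree_smul_le c H).trans hd.le) ?_)
  refine natDegree_sum_le_of_forall_le _ _ fun j _ => (natDegree_smul_le _ _).trans ?_
  rw [natDegree_sub_C, natDegree_X_pow]
  omega

theorem kernelPolynomial_eq_zero (hm : H.Monic) (hd : H.natDegree = d + 1) {c : ℝ} {a : Fin d → ℝ}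
    (h : kernelPolynomial l H c a = 0) : c = 0 ∧ a = 0 := by
  have hc : c = 0 := by
    have := congrArg (fun g => g.coeff (d + 1)) h
    have hHc : H.coeff (d + 1) = 1 := by rw [← hd]; exact hm.coeff_natDegree
    simpa [kernelPolynomial, finsetSum_coeff, hHc, coeff_X_pow, coeff_C, Fin.val_inj,
      fun j : Fin d => j.isLt.ne'] using this
  refine ⟨hc, funext fun i => ?_⟩
  have := congrArg (fun g => g.coeff (i.val + 1)) h
  simpa [kernelPolynomial, finsetSum_coeff, hc, coeff_X_pow, coeff_C, Fin.val_inj] using this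

/-- The top coefficient is the multiple of `H`; in the remainder, of degree at most `d`, the
constant term is forced by `l r = 0`. -/
theorem exists_eq_kernelPolynomial (h1 : l 1 = 1) (hm : H.Monic) (hd : H.natDegree = d + 1)
    (hH : l H = 0) {h : ℝ[X]} (hdeg : h.natDegree ≤ d + 1) (hl : l h = 0) :
    ∃ (c : ℝ) (a : Fin d → ℝ), h = kernelPolynomial l H c a := by
  let c := h.coeff (d + 1)
  let r := h - c • H
  have hr : r.natDegree < d + 1 := by
    have hHc : H.coeff (d + 1) = 1 := by rw [← hd]; exact hm.coeff_natDegree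
    have hle : r.natDegree ≤ d + 1 :=
      (natDegree_sub_le_of_le hdeg ((natDegree_smul_le c H).trans hd.le)).trans (max_self _).le
    refine lt_of_le_of_ne hle fun heq => ?_
    have h0 : r.coeff (d + 1) = 0 := by simp [r, c, hHc]
    rw [← heq, coeff_natDegree, leadingCoeff_eq_zero] at h0
    rw [h0, natDegree_zero] at heq
    omega
  have hlr : l r = 0 := by simp [r, hl, hH]
  refine ⟨c, fun j => r.coeff (j.val + 1), ?_⟩
  have hsum : r = ∑ j ∈ Finset.range (d + 1), r.coeff j • (X ^ j : ℝ[X]) := by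
    conv_lhs => rw [r.as_sum_range' (d + 1) hr]
    exact Finset.sum_congr rfl fun j _ => by rw [smul_X_eq_monomial]
  have hlsum : ∑ j ∈ Finset.range (d + 1), r.coeff j • C (l (X ^ j)) = 0 := by
    have := congrArg l hsum
    rw [hlr, map_sum] at this
    have := congrArg C this
    rw [map_sum, C_0] at this
    rw [this]
    exact Finset.sum_congr rfl fun j _ => by rw [map_smul, smul_eq_mul, C_mul, smul_eq_C_mul]
  have hr2 : r = ∑ j ∈ Finset.range (d + 1), r.coeff j • (X ^ j - C (l (X ^ j))) := by
    simp_rw [smul_sub, Finset.sum_sub_distrib]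
    rw [hlsum, sub_zero, ← hsum]
  rw [Finset.sum_range_succ', Finset.sum_range] at hr2
  simp only [pow_zero, h1, C_1, sub_self, smul_zero, add_zero] at hr2
  rw [kernelPolynomial, ← hr2]
  simp [r]

theorem eval_kernelPolynomial {i : Fin n} (hpos : 0 < H.eval (x i)) (c : ℝ) (a : Fin d → ℝ) :
    (kernelPolynomial l H c a).eval (x i) / H.eval (x i) =
      c + ∑ j, a j * projectedMoment d x l H i j := by
  rw [div_eq_iff hpos.ne', add_mul, Finset.sum_mul, kernelPolynomial, eval_add, eval_finsetSum]
  simp only [eval_smul, smul_eq_mul, eval_sub, eval_pow, eval_X, eval_C, projectedMoment]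
  congr 1
  refine Finset.sum_congr rfl fun j _ => ?_
  field_simp

theorem AffineMap.apply_eq_sum (f : (Fin d → ℝ) →ᵃ[ℝ] ℝ) (y : Fin d → ℝ) :
    f y = f 0 + ∑ j, f.linear (Pi.single j 1) * y j := by
  have h : f y = f.linear y + f 0 := congrFun f.decomp y
  rw [h, add_comm, f.linear.pi_apply_eq_sum_univ y]
  congr 1
  refine Finset.sum_congr rfl fun j _ => ?_
  rw [smul_eq_mul, mul_comm]
  congr 2
  ext i
  simp [Pi.single_apply, eq_comm]

/-- Affine functions on the chart are hyperplanes through the centre `l`, normalised by dividing by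
`H`. -/
theorem exists_polynomial_of_affineMap (h1 : l 1 = 1) (hm : H.Monic) (hd : H.natDegree = d + 1)
    (hH : l H = 0) (hpos : ∀ i, 0 < H.eval (x i)) (f : (Fin d → ℝ) →ᵃ[ℝ] ℝ) :
    ∃ h : ℝ[X], h.natDegree ≤ d + 1 ∧ l h = 0 ∧
      (∀ i, f (projectedMoment d x l H i) = h.eval (x i) / H.eval (x i)) ∧ (h = 0 → f = 0) := by
  refine ⟨kernelPolynomial l H (f 0) fun j => f.linear (Pi.single j 1),
    natDegree_kernelPolynomial_le hd _ _, map_kernelPolynomial h1 hH _ _, fun i => ?_, fun h => ?_⟩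
  · rw [eval_kernelPolynomial (hpos i), f.apply_eq_sum]
  · obtain ⟨hc, ha⟩ := kernelPolynomial_eq_zero hm hd h
    ext y
    rw [f.apply_eq_sum, hc]
    simp [fun j => congrFun ha j]

theorem exists_affineMap_of_polynomial (h1 : l 1 = 1) (hm : H.Monic) (hd : H.natDegree = d + 1)
    (hH : l H = 0) (hpos : ∀ i, 0 < H.eval (x i)) {h : ℝ[X]} (hdeg : h.natDegree ≤ d + 1)
    (hl : l h = 0) :
    ∃ f : (Fin d → ℝ) →ᵃ[ℝ] ℝ,
      ∀ i, f (projectedMoment d x l H i) = h.eval (x i) / H.eval (x i) := by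
  obtain ⟨c, a, rfl⟩ := exists_eq_kernelPolynomial h1 hm hd hH hdeg hl
  refine ⟨AffineMap.const ℝ _ c + (∑ j, a j • LinearMap.proj (R := ℝ) (φ := fun _ : Fin d => ℝ) j
    ).toAffineMap, fun i => ?_⟩
  rw [eval_kernelPolynomial (hpos i)]
  simp

theorem projectedMoment_injective (hx : Function.Injective x) (h1 : l 1 = 1) (hm : H.Monic)
    (hd : H.natDegree = d + 1) (hH : l H = 0) (hpos : ∀ i, 0 < H.eval (x i))
    (hsep : ∀ i j, i ≠ j → ∃ g : ℝ[X], g.natDegree ≤ d + 1 ∧ g.eval (x i) = 0 ∧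
      g.eval (x j) = 0 ∧ l g ≠ 0) :
    Function.Injective (projectedMoment d x l H) := by
  intro i j hij
  by_contra hne
  obtain ⟨g, hg, hgi, hgj, hlg⟩ := hsep i j hne
  have key : ∀ g : ℝ[X], g.natDegree ≤ d + 1 →
      (g.eval (x i) - l g) / H.eval (x i) = (g.eval (x j) - l g) / H.eval (x j) := by
    intro g hg
    obtain ⟨f, hf⟩ := exists_affineMap_of_polynomial h1 hm hd hH hpos (h := g - C (l g))
      (by rwa [natDegree_sub_C]) (by rw [map_sub, LinearMap.map_polynomial_C h1, sub_self])
    have := hf i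
    rw [hij, hf j] at this
    simpa using this.symm
  have e1 := key g hg
  have hi := hpos i
  have hj := hpos j
  -- Testing with `g` shows that `H` agrees at the two nodes; testing with `X` then identifies the
  -- nodes.
  rw [hgi, hgj, zero_sub, div_eq_div_iff hi.ne' hj.ne'] at e1
  have e2 := mul_left_cancel₀ (neg_ne_zero.2 hlg) e1
  have e3 := key X (by rw [natDegree_X]; omega)
  rw [e2, div_left_inj' hi.ne', eval_X, eval_X, sub_left_inj] at e3
  exact hne (hx e3)

theorem affineSpan_range_projectedMoment (hx : Function.Injective x) (h1 : l 1 = 1) (hm : H.Monic)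
    (hd : H.natDegree = d + 1) (hH : l H = 0) (hpos : ∀ i, 0 < H.eval (x i)) (hn : d + 1 < n) :
    affineSpan ℝ (Set.range (projectedMoment d x l H)) = ⊤ := by
  by_contra hne
  obtain ⟨g, hg, hz⟩ := AffineSubspace.exists_affineMap_ne_zero hne
  obtain ⟨h, hdeg, -, hev, hh⟩ := exists_polynomial_of_affineMap h1 hm hd hH hpos g
  have h0 : h ≠ 0 := fun h0 => hg (hh h0)
  have hcard := (Polynomial.card_filter_eval_eq_zero_le h0 hx).trans hdeg
  have : (Finset.univ.filter fun i => h.eval (x i) = 0) = Finset.univ := by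
    refine Finset.filter_true_of_mem fun i _ => ?_
    have := hev i
    rw [hz _ (subset_affineSpan ℝ _ ⟨i, rfl⟩), eq_comm, div_eq_zero_iff] at this
    exact this.resolve_right (hpos i).ne'
  rw [this, Finset.card_univ, Fintype.card_fin] at hcard
  omega

/-- A complex whose facets are cut out by polynomials of degree `d + 1` that are nonnegative on the
given nodes, and positive under a functional `l`, is regular. -/
theorem isRegularComplex_of_supporting_polynomials {Γ : Finset (Finset (Fin n))}
    (hΓ : IsPureComplex d Γ) (hx : Function.Injective x) (h1 : l 1 = 1) (hm : H.Monic)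
    (hd : H.natDegree = d + 1) (hH : l H = 0) (hpos : ∀ i, 0 < H.eval (x i)) (hn : d + 1 < n)
    (hsep : ∀ i j, i ≠ j → ∃ g : ℝ[X], g.natDegree ≤ d + 1 ∧ g.eval (x i) = 0 ∧
      g.eval (x j) = 0 ∧ l g ≠ 0)
    (hsupp : ∀ τ ∈ Γ, ∃ P : ℝ[X], P.natDegree ≤ d + 1 ∧ 0 < l P ∧ (∀ i, 0 ≤ P.eval (x i)) ∧
      ∀ i ∈ τ, P.eval (x i) = 0) :
    IsRegularComplex d Γ := by
  classical
  have hinj := projectedMoment_injective hx h1 hm hd hH hpos hsep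
  set p := projectedMoment d x l H
  let A : Finset (Fin d → ℝ) := Finset.univ.image p
  -- For `f = h / H`, lying below `ω` means `1 - h ≥ 0` at the nodes, with contact at the zeros.
  -- Since `l (1 - h) = 1`, this polynomial is nonzero and has at most `d + 1` zeros.
  let ω : (Fin d → ℝ) → ℝ := Function.extend p (fun i => 1 / H.eval (x i)) 0
  have hω : ∀ i, ω (p i) = 1 / H.eval (x i) := hinj.extend_apply _ _
  have hA : affineSpan ℝ (A : Set (Fin d → ℝ)) = ⊤ := by
    rw [Finset.coe_image, Finset.coe_univ, Set.image_univ]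
    exact affineSpan_range_projectedMoment hx h1 hm hd hH hpos hn
  have hsimp : IsSimplicialHeight A ω := by
    intro f hf
    obtain ⟨h, hdeg, hl, hev, -⟩ := exists_polynomial_of_affineMap h1 hm hd hH hpos f
    have h0 : 1 - h ≠ 0 := by
      intro h0
      have := congrArg l h0
      simp [h1, hl] at this
    rw [Module.finrank_fin_fun]
    have hdeg' : (1 - h).natDegree ≤ d + 1 :=
      (natDegree_sub_le_of_le (by simp) hdeg).trans (show max 0 (d + 1) ≤ d + 1 by simp)
    refine le_trans ?_ ((Polynomial.card_filter_eval_eq_zero_le h0 hx).trans hdeg')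
    rw [← Finset.card_image_of_injective _ hinj]
    refine Finset.card_le_card fun y hy => ?_
    obtain ⟨hyA, hy⟩ := mem_contactSet.1 hy
    obtain ⟨i, -, rfl⟩ := Finset.mem_image.1 hyA
    refine Finset.mem_image_of_mem _ (Finset.mem_filter.2 ⟨Finset.mem_univ _, ?_⟩)
    rw [hω, hev, div_left_inj' (hpos i).ne'] at hy
    rw [eval_sub, eval_one, hy, sub_self]
  refine ⟨hΓ, A, lowerHullComplex hsimp hA, p, isRegularTriangulation_lowerHullComplex hsimp hA,
    hinj.injOn, fun τ hτ => ?_⟩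
  obtain ⟨P, hdeg, hlP, hP0, hPτ⟩ := hsupp τ hτ
  -- Scaling `P` to value one under `l` puts the difference from `1` in the kernel.
  obtain ⟨f, hf⟩ := exists_affineMap_of_polynomial h1 hm hd hH hpos (h := 1 - (l P)⁻¹ • P)
    ((natDegree_sub_le_of_le (by simp) ((natDegree_smul_le _ _).trans hdeg)).trans
      (show max 0 (d + 1) ≤ d + 1 by simp))
    (by rw [map_sub, h1, map_smul, smul_eq_mul, inv_mul_cancel₀ hlP.ne', sub_self])
  have hτne : τ.Nonempty := Finset.card_pos.1 (by rw [hΓ τ hτ]; omega)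
  refine mem_lowerHullComplex_faces.2 ⟨hτne.image _, f, fun a ha => ?_, fun a ha => ?_⟩
  · obtain ⟨i, -, rfl⟩ := Finset.mem_image.1 ha
    rw [hω, hf, div_le_div_iff_of_pos_right (hpos i), eval_sub, eval_one, eval_smul, smul_eq_mul,
      sub_le_self_iff]
    exact mul_nonneg (inv_nonneg.2 hlP.le) (hP0 i)
  · obtain ⟨i, hi, rfl⟩ := Finset.mem_image.1 ha
    refine mem_contactSet.2 ⟨Finset.mem_image_of_mem _ (Finset.mem_univ _), ?_⟩
    rw [hω, hf, eval_sub, eval_smul, hPτ i hi]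
    simp

end MomentProjection

/-! ### Supporting polynomials and a point beyond a missing facet. -/

section CyclicFacets

open Polynomial

variable {m : ℕ}

/-- A quadratic polynomial that is nonnegative on the nodes `0, …, n - 1` and vanishes exactly at
`i` and its cyclic successor. -/
noncomputable def edgePolynomial {n : ℕ} (i : Fin n) : ℝ[X] :=
  if i.val + 1 = n then (C (i.val : ℝ) - X) * X else (X - C (i.val : ℝ)) * (X - C (i.val + 1 : ℝ))

theorem natDegree_edgePolynomial_le {n : ℕ} (i : Fin n) : (edgePolynomial i).natDegree ≤ 2 := by
  unfold edgePolynomial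
  split_ifs <;> compute_degree

theorem mul_sub_succ_nonneg (a b : ℕ) : 0 ≤ ((b : ℝ) - a) * ((b : ℝ) - (a + 1)) := by
  rcases Nat.lt_or_ge a b with h | h
  · have : (a : ℝ) + 1 ≤ b := by exact_mod_cast h
    exact mul_nonneg (by linarith) (by linarith)
  · have : (b : ℝ) ≤ a := by exact_mod_cast h
    exact mul_nonneg_of_nonpos_of_nonpos (by linarith) (by linarith)

theorem eval_edgePolynomial_nonneg {n : ℕ} (i j : Fin n) :
    0 ≤ (edgePolynomial i).eval (j.val : ℝ) := by
  unfold edgePolynomial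
  split_ifs with h
  · have : (j.val : ℝ) ≤ i.val := by
      have := j.isLt
      exact_mod_cast (by omega : j.val ≤ i.val)
    simp only [eval_mul, eval_sub, eval_C, eval_X]
    exact mul_nonneg (by linarith) (by positivity)
  · simpa using mul_sub_succ_nonneg i.val j.val

theorem eval_edgePolynomial_eq_zero_iff {n : ℕ} (i j : Fin n) :
    (edgePolynomial i).eval (j.val : ℝ) = 0 ↔ j = i ∨ j = cyclicSucc i := by
  rw [Fin.ext_iff, Fin.ext_iff, cyclicSucc_val]
  unfold edgePolynomial
  split_ifs with h
  · simp only [eval_mul, eval_sub, eval_C, eval_X, mul_eq_zero, sub_eq_zero, Nat.cast_inj,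
      Nat.cast_eq_zero]
    rw [eq_comm]
  · simp only [eval_mul, eval_sub, eval_C, eval_X, mul_eq_zero, sub_eq_zero, Nat.cast_inj]
    norm_cast

theorem exists_supporting_polynomial {k : ℕ} {τ : Finset (Fin (2 * m))} (hτ : τ ∈ SComplex m k) :
    ∃ P : ℝ[X], P.natDegree ≤ 2 * k ∧ (∀ i : Fin (2 * m), 0 ≤ P.eval (i.val : ℝ)) ∧
      ∀ i : Fin (2 * m), P.eval (i.val : ℝ) = 0 ↔ i ∈ τ := by
  obtain ⟨I, rfl, rfl, -, -⟩ := exists_of_mem_SComplex hτ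
  refine ⟨∏ i ∈ I, edgePolynomial i, ?_, fun j => ?_, fun j => ?_⟩
  · refine (natDegree_prod_le _ _).trans ?_
    refine (Finset.sum_le_card_nsmul I _ 2 fun i _ => natDegree_edgePolynomial_le i).trans ?_
    rw [smul_eq_mul, mul_comm]
  · rw [eval_prod]
    exact Finset.prod_nonneg fun i _ => eval_edgePolynomial_nonneg i j
  · rw [eval_prod, Finset.prod_eq_zero_iff]
    simp only [eval_edgePolynomial_eq_zero_iff, Finset.mem_union, Finset.mem_image]
    constructor
    · rintro ⟨i, hi, rfl | rfl⟩
      · exact Or.inl hi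
      · exact Or.inr ⟨i, hi, rfl⟩
    · rintro (hi | ⟨i, hi, rfl⟩)
      · exact ⟨j, hi, Or.inl rfl⟩
      · exact ⟨i, hi, Or.inr rfl⟩

/-- The vertices `1, …, 2k` (as elements of `Fin (2 * m)`): a facet of the cyclic polytope. -/
def baseFacet (m k : ℕ) : Finset (Fin (2 * m)) :=
  Finset.univ.filter fun i => 1 ≤ i.val ∧ i.val ≤ 2 * k

theorem mem_baseFacet {k : ℕ} {i : Fin (2 * m)} :
    i ∈ baseFacet m k ↔ 1 ≤ i.val ∧ i.val ≤ 2 * k := by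
  simp [baseFacet]

theorem card_baseFacet {k : ℕ} (hkm : k < m) : (baseFacet m k).card = 2 * k := by
  have : (baseFacet m k).map Fin.valEmbedding = Finset.Icc 1 (2 * k) := by
    ext a
    simp only [Finset.mem_map, mem_baseFacet, Fin.valEmbedding_apply, Finset.mem_Icc]
    constructor
    · rintro ⟨i, hi, rfl⟩
      exact hi
    · intro ha
      exact ⟨⟨a, by omega⟩, ha, rfl⟩
  rw [← Finset.card_map Fin.valEmbedding, this, Nat.card_Icc]
  omega

/-- The pair of values `0, 1` is right-only, but for `k ≥ 2` the next pair `2, 3` is full. -/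
theorem baseFacet_notMem_SComplex {k : ℕ} (hk : 2 ≤ k) (hkm : k < m) :
    baseFacet m k ∉ SComplex m k := by
  intro h
  have := (mem_SComplex_iff.1 h).2 ⟨1, by omega⟩ (by simp)
  have e : cyclicSucc (⟨1, by omega⟩ : Fin (2 * m)) = ⟨2, by omega⟩ := by
    apply Fin.ext
    rw [cyclicSucc_val]
    simp only
    split_ifs <;> omega
  rw [e, mem_baseFacet, mem_baseFacet, mem_baseFacet, mem_baseFacet, pairSwap_val, pairSwap_val]
    at this
  simp at this
  omega

/-- The polynomial supporting the facet `baseFacet`. -/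
noncomputable def basePolynomial (k : ℕ) : ℝ[X] :=
  ∏ j ∈ Finset.range k, (X - C ((2 * j + 1 : ℕ) : ℝ)) * (X - C ((2 * j + 1 : ℕ) + 1 : ℝ))

theorem monic_basePolynomial (k : ℕ) : (basePolynomial k).Monic :=
  monic_prod_of_monic _ _ fun _ _ => (monic_X_sub_C _).mul (monic_X_sub_C _)

theorem natDegree_basePolynomial (k : ℕ) : (basePolynomial k).natDegree = 2 * k := by
  rw [basePolynomial, natDegree_prod_of_monic _ _
    fun _ _ => (monic_X_sub_C _).mul (monic_X_sub_C _)]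
  simp only [(monic_X_sub_C _).natDegree_mul (monic_X_sub_C _), natDegree_X_sub_C]
  simp [mul_comm]

theorem eval_basePolynomial_nonneg (k b : ℕ) : 0 ≤ (basePolynomial k).eval (b : ℝ) := by
  rw [basePolynomial, eval_prod]
  refine Finset.prod_nonneg fun j _ => ?_
  simpa using mul_sub_succ_nonneg (2 * j + 1) b

theorem eval_basePolynomial_zero_pos (k : ℕ) : 0 < (basePolynomial k).eval (0 : ℝ) := by
  rw [basePolynomial, eval_prod]
  refine Finset.prod_pos fun j _ => ?_
  simp only [eval_mul, eval_sub, eval_C, eval_X, zero_sub, neg_mul_neg]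
  positivity

theorem eval_basePolynomial_eq_zero {k : ℕ} {i : Fin (2 * m)} (hi : i ∈ baseFacet m k) :
    (basePolynomial k).eval (i.val : ℝ) = 0 := by
  rw [mem_baseFacet] at hi
  rw [basePolynomial, eval_prod]
  refine Finset.prod_eq_zero (i := (i.val - 1) / 2) (Finset.mem_range.2 (by omega)) ?_
  simp only [eval_mul, eval_sub, eval_C, eval_X, mul_eq_zero, sub_eq_zero]
  norm_cast
  omega

/-- Evaluation at a point beyond the facet `F`, near its barycentre. -/
noncomputable def beyondFunctional {n : ℕ} (F : Finset (Fin n)) (ε : ℝ) : ℝ[X] →ₗ[ℝ] ℝ :=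
  ∑ i ∈ F, leval (i.val : ℝ) - ε • ∑ i, leval ((i : Fin n).val : ℝ)

theorem beyondFunctional_apply {n : ℕ} (F : Finset (Fin n)) (ε : ℝ) (g : ℝ[X]) :
    beyondFunctional F ε g =
      ∑ i ∈ F, g.eval (i.val : ℝ) - ε * ∑ i : Fin n, g.eval (i.val : ℝ) := by
  simp [beyondFunctional, leval]

/-- At `ε = 0` the functional is a sum of nonnegative values over `F`, one of them positive;
continuity does the rest. -/
theorem eventually_beyondFunctional_pos {n : ℕ} (F : Finset (Fin n)) {g : ℝ[X]}
    (hg : ∀ i : Fin n, 0 ≤ g.eval (i.val : ℝ)) {i : Fin n} (hi : i ∈ F)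
    (hne : g.eval (i.val : ℝ) ≠ 0) :
    ∀ᶠ ε in nhdsWithin (0 : ℝ) (Set.Ioi 0), 0 < beyondFunctional F ε g := by
  have hpos : 0 < ∑ i ∈ F, g.eval (i.val : ℝ) :=
    Finset.sum_pos' (fun j _ => hg j) ⟨i, hi, lt_of_le_of_ne (hg i) hne.symm⟩
  have hc : ContinuousAt (fun ε : ℝ => beyondFunctional F ε g) 0 := by
    simp only [beyondFunctional_apply]
    fun_prop
  exact ((continuousAt_const (y := (0 : ℝ))).eventually_lt hc
    (by simpa [beyondFunctional_apply] using hpos)).filter_mono nhdsWithin_le_nhds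

theorem isRegularComplex_SComplex {k : ℕ} (hk : 2 ≤ k) (hkm : k < m) :
    IsRegularComplex (2 * k - 1) (SComplex m k) := by
  classical
  set F := baseFacet m k with hF
  have hcard : F.card = 2 * k := card_baseFacet hkm
  have hdk : 2 * k - 1 + 1 = 2 * k := by omega
  have hpure : IsPureComplex (2 * k - 1) (SComplex m k) := fun τ hτ => by
    rw [(mem_SComplex_iff.1 hτ).1, hdk]
  choose! P hPdeg hP0 hPz using
    fun (τ : Finset (Fin (2 * m))) (hτ : τ ∈ SComplex m k) => exists_supporting_polynomial hτ
  -- These separate projected vertices; their degree 4 is at most `2k` because `k ≥ 2`.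
  let G : Fin (2 * m) → Fin (2 * m) → ℝ[X] :=
    fun i j => ((X - C (i.val : ℝ)) * (X - C (j.val : ℝ))) ^ 2
  have hFne : ∀ i j : Fin (2 * m), ∃ a ∈ F, a ≠ i ∧ a ≠ j := by
    intro i j
    have : ({i, j} : Finset (Fin (2 * m))).card < F.card :=
      Finset.card_le_two.trans_lt (by omega)
    obtain ⟨a, ha, h⟩ := Finset.exists_mem_notMem_of_card_lt_card this
    simp only [Finset.mem_insert, Finset.mem_singleton, not_or] at h
    exact ⟨a, ha, h⟩
  have ev1 : ∀ᶠ ε in nhdsWithin (0 : ℝ) (Set.Ioi 0), 0 < beyondFunctional F ε 1 := by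
    obtain ⟨a, ha, -⟩ := hFne ⟨0, by omega⟩ ⟨0, by omega⟩
    exact eventually_beyondFunctional_pos F (fun i => by simp) ha (by simp)
  have ev2 : ∀ᶠ ε in nhdsWithin (0 : ℝ) (Set.Ioi 0),
      ∀ τ ∈ SComplex m k, 0 < beyondFunctional F ε (P τ) := by
    rw [Filter.eventually_all_finset]
    intro τ hτ
    obtain ⟨a, ha, haτ⟩ : ∃ a ∈ F, a ∉ τ := by
      by_contra! hsub
      have heq : F = τ := Finset.eq_of_subset_of_card_le hsub
        (by rw [hcard, (mem_SComplex_iff.1 hτ).1])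
      exact baseFacet_notMem_SComplex hk hkm (hF ▸ heq ▸ hτ)
    exact eventually_beyondFunctional_pos F (hP0 τ hτ) ha fun h => haτ ((hPz τ hτ a).1 h)
  have ev3 : ∀ᶠ ε in nhdsWithin (0 : ℝ) (Set.Ioi 0),
      ∀ i j, 0 < beyondFunctional F ε (G i j) := by
    rw [Filter.eventually_all]
    intro i
    rw [Filter.eventually_all]
    intro j
    obtain ⟨a, ha, hai, haj⟩ := hFne i j
    refine eventually_beyondFunctional_pos F (fun b => ?_) ha ?_
    · simp only [G, eval_pow]
      positivity
    · simp [G, sub_eq_zero, Fin.val_inj, hai, haj]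
  obtain ⟨ε, ⟨⟨h1, h2⟩, h3⟩, hε⟩ := (((ev1.and ev2).and ev3).and self_mem_nhdsWithin).exists
  set L := beyondFunctional F ε with hL
  -- The polynomial vanishes on `F`, leaving only the `-ε` term, strict because of node `0`.
  have hQ : L (basePolynomial k) < 0 := by
    rw [hL, beyondFunctional_apply,
      Finset.sum_eq_zero fun i hi => eval_basePolynomial_eq_zero hi, zero_sub, neg_lt_zero]
    refine mul_pos hε (Finset.sum_pos' (fun i _ => eval_basePolynomial_nonneg k i.val)
      ⟨⟨0, by omega⟩, Finset.mem_univ _, ?_⟩)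
    simpa using eval_basePolynomial_zero_pos k
  -- Chosen so that `basePolynomial k + C δ` is killed by `L`; positivity of `δ` makes it positive
  -- at all nodes.
  set δ := -L (basePolynomial k) / L 1 with hδ
  have hδpos : 0 < δ := div_pos (neg_pos.2 hQ) h1
  have hlp : ∀ g, 0 < L g → 0 < ((L 1)⁻¹ • L) g := fun g hg => mul_pos (inv_pos.2 h1) hg
  refine isRegularComplex_of_supporting_polynomials (x := fun i : Fin (2 * m) => (i.val : ℝ))
    (l := (L 1)⁻¹ • L) (H := basePolynomial k + C δ) hpure
    (fun i j h => Fin.ext (Nat.cast_injective h)) (inv_mul_cancel₀ h1.ne') ?_ ?_ ?_ ?_ (by omega)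
    (fun i j _ => ⟨G i j, ?_, by simp [G], by simp [G], (hlp _ (h3 i j)).ne'⟩)
    (fun τ hτ => ⟨P τ, by rw [hdk]; exact hPdeg τ hτ, hlp _ (h2 τ hτ), hP0 τ hτ,
      fun i hi => (hPz τ hτ i).2 hi⟩)
  · refine (monic_basePolynomial k).add_of_left (degree_C_le.trans_lt ?_)
    rw [← natDegree_pos_iff_degree_pos, natDegree_basePolynomial]
    omega
  · rw [natDegree_add_C, natDegree_basePolynomial, hdk]
  · have : L (C δ) = δ * L 1 := by
      rw [← mul_one (C δ), ← smul_eq_C_mul, map_smul, smul_eq_mul]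
    rw [LinearMap.smul_apply, map_add, this, hδ, div_mul_cancel₀ _ h1.ne', add_neg_cancel, smul_zero]
  · intro i
    rw [eval_add, eval_C]
    have := eval_basePolynomial_nonneg k i.val
    linarith
  · have : (G i j).natDegree ≤ 4 := by
      simp only [G]
      compute_degree
    omega

end CyclicFacets

theorem theorem6p5 (m k : ℕ) (hk : 1 ≤ k) (hkm : k < m) :
    relabelComplex (pairSwap m) (SComplex m k) = complementComplex (SComplex m (m - k)) ∧
    PositivelyDecorable (2 * k - 1) (SComplex m k) ∧
    (2 ≤ k → IsRegularComplex (2 * k - 1) (SComplex m k)) :=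
  ⟨relabel_SComplex_eq_complement hkm, positivelyDecorable_SComplex hk,
    fun hk2 => isRegularComplex_SComplex hk2 hkm⟩
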